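/- For a permutation $\pi=a_1a_2\cdots a_n$ of $[n]=\{1,\dots,n\}$, an index $i$ with $1\le i\le n-1$ is a descent of $\pi$ if $a_i>a_{i+1}$; it is an odd (even) descent if $i$ is odd (even). For $n\ge 1$ and $k\in\mathbb{Z}$ let $a_{n,k}$ be the number of permutations of $[n]$ with exactly $k$ even descents and no odd descents (so $a_{n,k}=0$ for $k<0$). Let $E_n$ be the Euler number, i.e. the number of alternating permutations $a_1>a_2<a_3>\cdots$ of $[n]$. Then for all integers $n\ge k\ge 1$, $$a_{2n,k}=(n-k)\,a_{2n-1,k-1}+(k+1)\,a_{2n-1,k},$$ $$a_{2n+1,k}=(n-k+1)\,a_{2n,k-2}+(n+1)\,a_{2n,k-1}+(k+1)\,a_{2n,k},$$ and for all $n\ge 1$, $a_{n,0}=1$ and $a_{n,\lfloor (n-1)/2\rfloor}=E_n$. -/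

import Mathlib

namespace RefinedEulerian

/-- A permutation `a₁a₂⋯aₙ` of `[n]` is modelled by `π : Equiv.Perm (Fin n)`, with
`aᵢ = π (i - 1) + 1` for `1 ≤ i ≤ n`. The (1-based) index `i` is a descent of `π`
if `1 ≤ i ≤ n - 1` and `aᵢ > aᵢ₊₁`. -/
def IsDescent {n : ℕ} (π : Equiv.Perm (Fin n)) (i : ℕ) : Prop :=
  ∃ h : 1 ≤ i ∧ i < n, π ⟨i - 1, by omega⟩ > π ⟨i, h.2⟩

instance {n : ℕ} (π : Equiv.Perm (Fin n)) (i : ℕ) : Decidable (IsDescent π i) := by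
  unfold IsDescent; infer_instance

/-- The number of descents of `π` in odd positions. -/
def odes {n : ℕ} (π : Equiv.Perm (Fin n)) : ℕ :=
  ((Finset.range n).filter fun i => Odd i ∧ IsDescent π i).card

/-- The number of descents of `π` in even positions. -/
def edes {n : ℕ} (π : Equiv.Perm (Fin n)) : ℕ :=
  ((Finset.range n).filter fun i => Even i ∧ IsDescent π i).card

/-- `a n k` is the number of permutations of `[n]` with exactly `k` even descents and no odd
descents. The index `k` is an integer, so `a n k = 0` for `k < 0`. -/
def a (n : ℕ) (k : ℤ) : ℕ :=
  (Finset.univ.filter fun π : Equiv.Perm (Fin n) => odes π = 0 ∧ (edes π : ℤ) = k).card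

/-- `π` is alternating: `a₁ > a₂ < a₃ > ⋯`. -/
def IsAlternating {n : ℕ} (π : Equiv.Perm (Fin n)) : Prop :=
  ∀ (i : ℕ) (h : 1 ≤ i ∧ i < n),
    (Odd i → π ⟨i - 1, by omega⟩ > π ⟨i, h.2⟩) ∧
    (Even i → π ⟨i - 1, by omega⟩ < π ⟨i, h.2⟩)

open Classical in
/-- The Euler number `Eₙ`: the number of alternating permutations of `[n]`. -/
noncomputable def eulerNumber (n : ℕ) : ℕ :=
  (Finset.univ.filter fun π : Equiv.Perm (Fin n) => IsAlternating π).card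

end RefinedEulerian

namespace RefinedEulerian

/-! A word without odd descents is a string of increasing pairs, followed by a single letter if the
length is odd. Its even descents are the descents between neighbouring blocks. Both recurrences come
from deleting the largest letter `M` and summing an arbitrary function `f` of the number `d` of
descents. Taking `f` to be an indicator at the end gives the recurrences.

For even length, `M` closes a pair `(x, M)`. The word `A (x, M) B` corresponds to the odd word `B A
x` together with the place where `B A` is cut. The outermost cut keeps `d`. An inner cut at a
descent also keeps `d`, since `M` creates a new descent, and any other inner cut gives `d + 1`. See
`sum_evenWords_succ`.

For odd length, either `M` is last and can be dropped, or the word contains `(x, M)` and ends in `y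
≠ x`. In the second case `x` and `y` form an increasing pair `(p, q)` marked in an even word `A (p,
q) B`. The two orders of `x` and `y` give `A (p, M) B q` and `B (q, M) A p`, which have equally many
descents. This number depends on comparing the last letters of `A (p, q)` and `B`; exchanging the
two parts averages the comparison out. See `sum_oddWords`.

The boundary values come from the identity and from complementing values. -/

/-! ### Lists of pairs and their descents -/

/-- The word spelled by a list of pairs. -/
def letters : List (ℕ × ℕ) → List ℕ
  | [] => []
  | p :: l => p.1 :: p.2 :: letters l

/-- The consecutive pairs of a word; an unpaired last letter is dropped. -/
def pairs : List ℕ → List (ℕ × ℕ)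
  | x :: y :: l => (x, y) :: pairs l
  | _ => []

/-- The number of descents between consecutive pairs. -/
def des : List (ℕ × ℕ) → ℤ
  | [] => 0
  | [_] => 0
  | p :: q :: l => (if q.1 < p.2 then 1 else 0) + des (q :: l)

@[simp] theorem letters_nil : letters [] = [] := rfl

@[simp] theorem letters_cons (p : ℕ × ℕ) (l : List (ℕ × ℕ)) :
    letters (p :: l) = p.1 :: p.2 :: letters l := rfl

@[simp] theorem letters_append (A B : List (ℕ × ℕ)) :
    letters (A ++ B) = letters A ++ letters B := by
  induction A with
  | nil => rfl
  | cons p A ih => simp [ih]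

@[simp] theorem length_letters (l : List (ℕ × ℕ)) : (letters l).length = 2 * l.length := by
  induction l with
  | nil => rfl
  | cons p l ih => simp [ih]; ring

theorem mem_letters {l : List (ℕ × ℕ)} {x : ℕ} :
    x ∈ letters l ↔ ∃ p ∈ l, x = p.1 ∨ x = p.2 := by
  induction l with
  | nil => simp
  | cons p l ih => simp [ih, or_assoc]

theorem pairs_letters (l : List (ℕ × ℕ)) : pairs (letters l) = l := by
  induction l with
  | nil => rfl
  | cons p l ih => simp [pairs, ih]

theorem letters_pairs : ∀ (n : ℕ) (w : List ℕ), w.length = 2 * n → letters (pairs w) = w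
  | 0, w, h => by
    have : w = [] := List.length_eq_zero_iff.1 (by simpa using h)
    subst this; rfl
  | n + 1, x :: y :: w, h => by
    have := letters_pairs n w (by simp at h; omega)
    simp [pairs, this]
  | n + 1, [], h => by simp at h
  | n + 1, [x], h => by simp at h; omega

@[simp] theorem des_nil : des [] = 0 := rfl

@[simp] theorem des_singleton (p : ℕ × ℕ) : des [p] = 0 := rfl

theorem des_cons_cons (p q : ℕ × ℕ) (l : List (ℕ × ℕ)) :
    des (p :: q :: l) = (if q.1 < p.2 then 1 else 0) + des (q :: l) := rfl

theorem des_append_cons_cons (A : List (ℕ × ℕ)) (p q : ℕ × ℕ) (B : List (ℕ × ℕ)) :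
    des (A ++ p :: q :: B) = des (A ++ [p]) + (if q.1 < p.2 then 1 else 0) + des (q :: B) := by
  induction A with
  | nil => simp [des_cons_cons]
  | cons a A ih =>
    cases A with
    | nil => simp [des_cons_cons]; ring
    | cons b A =>
      simp only [List.cons_append, des_cons_cons] at ih ⊢
      rw [ih]; ring

/-- The second entry of the last pair is never compared with anything. An odd word with last letter
`x` can therefore be treated as a list of pairs ending in the padded pair `(x, 0)`. -/
theorem des_append_singleton (A : List (ℕ × ℕ)) (x u v : ℕ) :
    des (A ++ [(x, u)]) = des (A ++ [(x, v)]) := by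
  induction A with
  | nil => rfl
  | cons a A ih =>
    cases A with
    | nil => rfl
    | cons b A =>
      simp only [List.cons_append, des_cons_cons] at ih ⊢
      rw [ih]

/-- Cutting a list of pairs at all inner cut points. -/
theorem sum_des_take_add_des_drop (l : List (ℕ × ℕ)) (hl : l ≠ []) (φ : ℤ → ℤ) :
    ∑ g ∈ Finset.Ico 1 l.length, φ (des (l.take g) + des (l.drop g)) =
      des l * φ (des l - 1) + (l.length - 1 - des l) * φ (des l) := by
  induction l generalizing φ with
  | nil => exact absurd rfl hl
  | cons p l ih =>
    cases l with
    | nil => simp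
    | cons q l =>
      rw [Finset.sum_eq_sum_Ico_succ_bot (by simp)]
      have hshift : ∑ g ∈ Finset.Ico (1 + 1) (p :: q :: l).length,
            φ (des ((p :: q :: l).take g) + des ((p :: q :: l).drop g)) =
          ∑ g ∈ Finset.Ico 1 (q :: l).length,
            φ ((if q.1 < p.2 then 1 else 0) +
              (des ((q :: l).take g) + des ((q :: l).drop g))) := by
        rw [List.length_cons, ← Finset.sum_Ico_add' _ 1 (q :: l).length 1]
        refine Finset.sum_congr rfl fun g hg => ?_
        obtain ⟨g, rfl⟩ : ∃ k, g = k + 1 := ⟨g - 1, by simp at hg; omega⟩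
        simp only [← add_assoc, List.take_succ_cons, List.drop_succ_cons, des_cons_cons]
      -- Every cut beyond the first keeps the comparison of `p` with `q`; this constant is absorbed
      -- into `φ`.
      rw [hshift, ih (by simp) fun d => φ ((if q.1 < p.2 then 1 else 0) + d)]
      simp only [List.take_succ_cons, List.take_zero, List.drop_succ_cons, List.drop_zero,
        des_singleton, des_cons_cons, List.length_cons]
      split_ifs
      · push_cast; ring_nf
      · push_cast; ring_nf

/-! ### The words to be counted -/

/-- Words on `0, …, 2n - 1` without odd descents, as lists of pairs. -/
def evenWords (n : ℕ) : Finset (List (ℕ × ℕ)) :=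
  ((List.range (2 * n)).permutations.map pairs).toFinset.filter fun l => ∀ p ∈ l, p.1 < p.2

/-- Words on `0, …, 2n` without odd descents, as lists of pairs together with the last letter. -/
def oddWords (n : ℕ) : Finset (List (ℕ × ℕ) × ℕ) :=
  ((List.range (2 * n + 1)).permutations.map
    fun w => (pairs w.dropLast, w.getLastD 0)).toFinset.filter fun s => ∀ p ∈ s.1, p.1 < p.2

theorem mem_evenWords {n : ℕ} {l : List (ℕ × ℕ)} :
    l ∈ evenWords n ↔ (letters l).Perm (List.range (2 * n)) ∧ ∀ p ∈ l, p.1 < p.2 := by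
  simp only [evenWords, Finset.mem_filter, List.mem_toFinset, List.mem_map,
    List.mem_permutations, and_congr_left_iff]
  intro _
  constructor
  · rintro ⟨w, hw, rfl⟩
    rwa [letters_pairs n w (by simpa using hw.length_eq)]
  · intro h
    exact ⟨_, h, pairs_letters l⟩

theorem mem_oddWords {n : ℕ} {l : List (ℕ × ℕ)} {y : ℕ} :
    (l, y) ∈ oddWords n ↔
      (letters l ++ [y]).Perm (List.range (2 * n + 1)) ∧ ∀ p ∈ l, p.1 < p.2 := by
  simp only [oddWords, Finset.mem_filter, List.mem_toFinset, List.mem_map,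
    List.mem_permutations, and_congr_left_iff, Prod.mk.injEq]
  intro _
  constructor
  · rintro ⟨w, hw, rfl, rfl⟩
    have hlen : w.length = 2 * n + 1 := by simpa using hw.length_eq
    have hne : w ≠ [] := by rintro rfl; simp at hlen
    rw [letters_pairs n _ (by simp [hlen]), List.getLastD_eq_getLast?,
      List.getLast?_eq_some_getLast hne, Option.getD_some, List.dropLast_append_getLast hne]
    exact hw
  · intro h
    exact ⟨_, h, by simp [pairs_letters], by simp⟩

theorem length_of_mem_evenWords {n : ℕ} {l : List (ℕ × ℕ)} (h : l ∈ evenWords n) :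
    l.length = n := by
  have := (mem_evenWords.1 h).1.length_eq
  simp at this
  omega

theorem length_of_mem_oddWords {n : ℕ} {l : List (ℕ × ℕ)} {y : ℕ} (h : (l, y) ∈ oddWords n) :
    l.length = n := by
  have := (mem_oddWords.1 h).1.length_eq
  simp at this
  omega

theorem snd_lt_of_mem_evenWords {n : ℕ} {l : List (ℕ × ℕ)} (h : l ∈ evenWords n)
    {p : ℕ × ℕ} (hp : p ∈ l) : p.2 < 2 * n :=
  List.mem_range.1 ((mem_evenWords.1 h).1.subset (mem_letters.2 ⟨p, hp, Or.inr rfl⟩))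

theorem snd_lt_of_mem_oddWords {n : ℕ} {l : List (ℕ × ℕ)} {y : ℕ} (h : (l, y) ∈ oddWords n)
    {p : ℕ × ℕ} (hp : p ∈ l) : p.2 < 2 * n + 1 :=
  List.mem_range.1 ((mem_oddWords.1 h).1.subset
    (List.mem_append_left _ (mem_letters.2 ⟨p, hp, Or.inr rfl⟩)))

/-! ### Even length: deleting the largest letter -/

/-- A pair with a marked second entry splits a list in a unique way. -/
theorem append_cons_inj {M x x' : ℕ} {A A' B B' : List (ℕ × ℕ)}
    (hA : ∀ p ∈ A, p.2 ≠ M) (hA' : ∀ p ∈ A', p.2 ≠ M)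
    (h : A ++ (x, M) :: B = A' ++ (x', M) :: B') : A = A' ∧ x = x' ∧ B = B' := by
  induction A generalizing A' with
  | nil =>
    cases A' with
    | nil => simpa using h
    | cons a A' =>
      simp only [List.nil_append, List.cons_append, List.cons.injEq] at h
      exact absurd (by rw [← h.1]) (hA' a (by simp))
  | cons a A ih =>
    cases A' with
    | nil =>
      simp only [List.nil_append, List.cons_append, List.cons.injEq] at h
      exact absurd (by rw [h.1]) (hA a (by simp))
    | cons a' A' =>
      simp only [List.cons_append, List.cons.injEq] at h
      obtain ⟨h1, h2, h3⟩ := ih (fun p hp => hA p (by simp [hp]))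
        (fun p hp => hA' p (by simp [hp])) h.2
      exact ⟨by rw [h.1, h1], h2, h3⟩

theorem insert_mem_evenWords {n x : ℕ} {A B : List (ℕ × ℕ)} :
    A ++ (x, 2 * n + 1) :: B ∈ evenWords (n + 1) ↔ (B ++ A, x) ∈ oddWords n := by
  rw [mem_evenWords, mem_oddWords]
  have hperm : (letters (A ++ (x, 2 * n + 1) :: B)).Perm (List.range (2 * (n + 1))) ↔
      (letters (B ++ A) ++ [x]).Perm (List.range (2 * n + 1)) := by
    rw [show 2 * (n + 1) = 2 * n + 1 + 1 by ring, List.range_succ, List.perm_iff_count,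
      List.perm_iff_count]
    refine forall_congr' fun c => ?_
    simp only [letters_append, letters_cons, List.count_append, List.count_cons, List.count_nil]
    omega
  rw [hperm]
  refine and_congr_right fun h => ?_
  have hx : x < 2 * n + 1 := List.mem_range.1 (h.subset (by simp))
  constructor
  · intro H p hp
    exact H p (by simp at hp ⊢; tauto)
  · intro H p hp
    simp only [List.mem_append, List.mem_cons] at hp
    rcases hp with hp | rfl | hp
    · exact H p (by simp [hp])
    · exact hx
    · exact H p (by simp [hp])

/-- The largest letter cannot open an increasing pair. -/
theorem exists_eq_of_mem_evenWords {n : ℕ} {l : List (ℕ × ℕ)} (h : l ∈ evenWords (n + 1)) :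
    ∃ A x B, l = A ++ (x, 2 * n + 1) :: B := by
  have hm : 2 * n + 1 ∈ letters l :=
    (mem_evenWords.1 h).1.symm.subset (List.mem_range.2 (by omega))
  obtain ⟨⟨x, y⟩, hp, hxy⟩ := mem_letters.1 hm
  have h1 := (mem_evenWords.1 h).2 _ hp
  have h2 := snd_lt_of_mem_evenWords h hp
  obtain ⟨A, B, rfl⟩ := List.append_of_mem hp
  refine ⟨A, x, B, ?_⟩
  simp only at h1 h2 hxy
  rw [show y = 2 * n + 1 by omega]

/-- For `g ≥ 1`, moving the first `g` pairs behind `(x, 2 * n + 1)` cuts `l ++ [(x, 0)]` at an inner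
place and adds one descent after the maximum. The term `g = 0` moves nothing and accounts for the `+
1` in the first coefficient. -/
theorem sum_des_rotations {n : ℕ} {l : List (ℕ × ℕ)} {x : ℕ} (h : (l, x) ∈ oddWords n)
    (f : ℤ → ℤ) :
    ∑ g ∈ Finset.range (n + 1), f (des (l.drop g ++ (x, 2 * n + 1) :: l.take g)) =
      (des (l ++ [(x, 0)]) + 1) * f (des (l ++ [(x, 0)])) +
        (n - des (l ++ [(x, 0)])) * f (des (l ++ [(x, 0)]) + 1) := by
  have hlen := length_of_mem_oddWords h
  have key := sum_des_take_add_des_drop (l ++ [(x, 0)]) (by simp) fun d => f (d + 1)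
  rw [Finset.range_eq_Ico, Finset.sum_eq_sum_Ico_succ_bot (by omega)]
  have hsum : ∑ g ∈ Finset.Ico (0 + 1) (n + 1),
        f (des (l.drop g ++ (x, 2 * n + 1) :: l.take g)) =
      ∑ g ∈ Finset.Ico 1 (l ++ [(x, 0)]).length,
        f (des ((l ++ [(x, 0)]).take g) + des ((l ++ [(x, 0)]).drop g) + 1) := by
    have hlen' : (l ++ [(x, 0)]).length = n + 1 := by simp [hlen]
    rw [hlen']
    refine Finset.sum_congr rfl fun g hg => ?_
    rw [Finset.mem_Ico] at hg
    rw [List.take_append_of_le_length (by omega), List.drop_append_of_le_length (by omega)]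
    obtain ⟨q, B, hB⟩ : ∃ q B, l.take g = q :: B :=
      List.exists_cons_of_ne_nil fun h0 => by
        have := congrArg List.length h0
        rw [List.length_take, List.length_nil] at this
        omega
    have hq : q ∈ l := List.mem_of_mem_take (hB ▸ List.mem_cons_self : q ∈ l.take g)
    have h1 := snd_lt_of_mem_oddWords h hq
    have h2 := (mem_oddWords.1 h).2 q hq
    rw [hB, des_append_cons_cons, if_pos (by simp only; omega),
      des_append_singleton _ x (2 * n + 1) 0]
    congr 1; ring
  rw [hsum, key, List.drop_zero, List.take_zero, des_append_singleton _ x (2 * n + 1) 0]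
  simp only [List.length_append, hlen, List.length_singleton]
  push_cast
  rw [show des (l ++ [(x, 0)]) - 1 + 1 = des (l ++ [(x, 0)]) by ring]
  ring

theorem sum_evenWords_succ (n : ℕ) (f : ℤ → ℤ) :
    ∑ l ∈ evenWords (n + 1), f (des l) =
      ∑ s ∈ oddWords n,
        ((des (s.1 ++ [(s.2, 0)]) + 1) * f (des (s.1 ++ [(s.2, 0)])) +
          (n - des (s.1 ++ [(s.2, 0)])) * f (des (s.1 ++ [(s.2, 0)]) + 1)) := by
  rw [← Finset.sum_congr rfl fun s (hs : s ∈ oddWords n) => sum_des_rotations hs f,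
    ← Finset.sum_product' (oddWords n) (Finset.range (n + 1))
      fun s g => f (des (s.1.drop g ++ (s.2, 2 * n + 1) :: s.1.take g))]
  symm
  refine Finset.sum_bij
    (fun t _ => t.1.1.drop t.2 ++ (t.1.2, 2 * n + 1) :: t.1.1.take t.2) ?_ ?_ ?_ ?_
  · rintro ⟨⟨l, x⟩, g⟩ h
    rw [Finset.mem_product] at h
    rw [insert_mem_evenWords, List.take_append_drop]
    exact h.1
  -- The unique maximum determines both parts, and `g` is the length of the part after it.
  · rintro ⟨⟨l, x⟩, g⟩ h ⟨⟨l', x'⟩, g'⟩ h' heq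
    simp only [Finset.mem_product, Finset.mem_range] at h h' heq
    obtain ⟨h1, rfl, h2⟩ := append_cons_inj
      (fun p hp => (snd_lt_of_mem_oddWords h.1 (List.mem_of_mem_drop hp)).ne)
      (fun p hp => (snd_lt_of_mem_oddWords h'.1 (List.mem_of_mem_drop hp)).ne) heq
    have hl : l = l' := by
      rw [← List.take_append_drop g l, ← List.take_append_drop g' l', h1, h2]
    have hg := congrArg List.length h2
    have e1 := length_of_mem_oddWords h.1
    have e2 := length_of_mem_oddWords h'.1
    rw [List.length_take, List.length_take] at hg
    simp only [Prod.mk.injEq]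
    exact ⟨⟨hl, trivial⟩, by omega⟩
  · intro l hl
    obtain ⟨A, x, B, rfl⟩ := exists_eq_of_mem_evenWords hl
    have hm := insert_mem_evenWords.1 hl
    have hlen := length_of_mem_oddWords hm
    rw [List.length_append] at hlen
    refine ⟨((B ++ A, x), B.length), ?_, ?_⟩
    · rw [Finset.mem_product, Finset.mem_range]
      exact ⟨hm, by simp only; omega⟩
    · simp
  · intro t _
    rfl

/-! ### Odd length: deleting the largest letter -/

/-- The last letter of a nonempty list of pairs. -/
def lastLetter (l : List (ℕ × ℕ)) : ℕ := (l.getLastD (0, 0)).2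

@[simp] theorem lastLetter_nil : lastLetter [] = 0 := rfl

@[simp] theorem lastLetter_append_singleton (A : List (ℕ × ℕ)) (p : ℕ × ℕ) :
    lastLetter (A ++ [p]) = p.2 := by
  simp [lastLetter]

theorem exists_append_singleton {l : List (ℕ × ℕ)} (hl : l ≠ []) :
    ∃ A p q, l = A ++ [(p, q)] :=
  ⟨l.dropLast, (l.getLast hl).1, (l.getLast hl).2, (List.dropLast_append_getLast hl).symm⟩

/-- The convention `lastLetter [] = 0` makes the comparison false for empty `B`, as needed. -/
theorem des_append_last (B : List (ℕ × ℕ)) (y u : ℕ) :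
    des (B ++ [(y, u)]) = des B + if y < lastLetter B then 1 else 0 := by
  rcases eq_or_ne B [] with rfl | hB
  · simp
  · obtain ⟨A, p, q, rfl⟩ := exists_append_singleton hB
    rw [List.append_assoc, List.singleton_append, des_append_cons_cons]
    simp

theorem lastLetter_mem {l : List (ℕ × ℕ)} (hl : l ≠ []) : lastLetter l ∈ letters l := by
  obtain ⟨A, p, q, rfl⟩ := exists_append_singleton hl
  simp

theorem lastLetter_lt {l : List (ℕ × ℕ)} {N : ℕ} (h : ∀ p ∈ l, p.2 < N) (hN : 0 < N) :
    lastLetter l < N := by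
  rcases eq_or_ne l [] with rfl | hl
  · simpa
  · obtain ⟨A, p, q, rfl⟩ := exists_append_singleton hl
    simpa using h (p, q) (by simp)

/-- Descents after inserting a maximal letter in an odd word. -/
theorem des_insert_max {A B : List (ℕ × ℕ)} {x y N : ℕ} (hB : ∀ p ∈ B, p.1 < N) (hy : y < N) :
    des (A ++ (x, N) :: B ++ [(y, 0)]) = des (A ++ [(x, 0)]) + 1 + des (B ++ [(y, 0)]) := by
  obtain ⟨r, R, hR, hr⟩ : ∃ r R, B ++ [(y, 0)] = r :: R ∧ r.1 < N := by
    cases B with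
    | nil => exact ⟨_, _, rfl, hy⟩
    | cons b B => exact ⟨b, B ++ [(y, 0)], rfl, hB b (by simp)⟩
  rw [List.append_assoc, List.cons_append, hR, des_append_cons_cons, if_pos hr,
    des_append_singleton A x N 0]

/-- Exchanging the two parts at an inner cut is an involution on even words with such a cut; `g`
becomes `n - g`. -/
theorem sum_evenWords_swap (n : ℕ) (H : List (ℕ × ℕ) → List (ℕ × ℕ) → ℤ) :
    ∑ l ∈ evenWords n, ∑ g ∈ Finset.Ico 1 n, H (l.take g) (l.drop g) =
      ∑ l ∈ evenWords n, ∑ g ∈ Finset.Ico 1 n, H (l.drop g) (l.take g) := by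
  rw [← Finset.sum_product' (evenWords n) (Finset.Ico 1 n) fun l g => H (l.take g) (l.drop g),
    ← Finset.sum_product' (evenWords n) (Finset.Ico 1 n) fun l g => H (l.drop g) (l.take g)]
  have hmap : ∀ t ∈ evenWords n ×ˢ Finset.Ico 1 n,
      (t.1.drop t.2 ++ t.1.take t.2, n - t.2) ∈ evenWords n ×ˢ Finset.Ico 1 n := by
    rintro ⟨l, g⟩ h
    simp only [Finset.mem_product, Finset.mem_Ico] at h ⊢
    obtain ⟨hl, hg⟩ := h
    refine ⟨?_, by omega⟩
    rw [mem_evenWords] at hl ⊢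
    constructor
    · refine List.Perm.trans ?_ hl.1
      rw [letters_append]
      refine List.perm_append_comm.trans ?_
      rw [← letters_append, List.take_append_drop]
    · intro p hp
      rw [List.mem_append] at hp
      exact hl.2 p (hp.elim List.mem_of_mem_drop List.mem_of_mem_take)
  have hparts : ∀ t ∈ evenWords n ×ˢ Finset.Ico 1 n,
      (t.1.drop t.2 ++ t.1.take t.2).take (n - t.2) = t.1.drop t.2 ∧
      (t.1.drop t.2 ++ t.1.take t.2).drop (n - t.2) = t.1.take t.2 := by
    rintro ⟨l, g⟩ h
    simp only [Finset.mem_product, Finset.mem_Ico] at h ⊢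
    have hlen : (l.drop g).length = n - g := by
      rw [List.length_drop, length_of_mem_evenWords h.1]
    exact ⟨List.take_left' hlen, List.drop_left' hlen⟩
  have hinv : ∀ t ∈ evenWords n ×ˢ Finset.Ico 1 n,
      ((t.1.drop t.2 ++ t.1.take t.2).drop (n - t.2) ++
        (t.1.drop t.2 ++ t.1.take t.2).take (n - t.2), n - (n - t.2)) = t := by
    intro t ht
    rw [(hparts t ht).1, (hparts t ht).2, List.take_append_drop]
    rw [Finset.mem_product, Finset.mem_Ico] at ht
    rw [Nat.sub_sub_self (by omega)]
  exact Finset.sum_bij' (fun t _ => (t.1.drop t.2 ++ t.1.take t.2, n - t.2))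
    (fun t _ => (t.1.drop t.2 ++ t.1.take t.2, n - t.2)) hmap hmap hinv hinv
    fun t ht => by simp only [(hparts t ht).1, (hparts t ht).2]

/-- A set parametrized by the even words with a marked pair. -/
theorem sum_marked_pairs {β : Type*} {n : ℕ} {T : Finset β}
    (ψ : List (ℕ × ℕ) → ℕ → ℕ → List (ℕ × ℕ) → β) (F : β → ℤ)
    (H : List (ℕ × ℕ) → List (ℕ × ℕ) → ℤ)
    (hmem : ∀ s, s ∈ T ↔ ∃ A p q B, A ++ (p, q) :: B ∈ evenWords n ∧ ψ A p q B = s)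
    (hinj : ∀ A p q B A' p' q' B', A ++ (p, q) :: B ∈ evenWords n →
      A' ++ (p', q') :: B' ∈ evenWords n → ψ A p q B = ψ A' p' q' B' →
      A = A' ∧ p = p' ∧ q = q' ∧ B = B')
    (hF : ∀ A p q B, A ++ (p, q) :: B ∈ evenWords n →
      F (ψ A p q B) = H (A ++ [(p, q)]) B) :
    ∑ s ∈ T, F s =
      ∑ l ∈ evenWords n, ∑ g ∈ Finset.Ico 1 (n + 1), H (l.take g) (l.drop g) := by
  rw [← Finset.sum_product' (evenWords n) (Finset.Ico 1 (n + 1))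
    fun l g => H (l.take g) (l.drop g)]
  have hsplit : ∀ t ∈ evenWords n ×ˢ Finset.Ico 1 (n + 1), ∃ A p q B,
      A ++ (p, q) :: B ∈ evenWords n ∧ t = (A ++ (p, q) :: B, A.length + 1) := by
    rintro ⟨l, g⟩ h
    simp only [Finset.mem_product, Finset.mem_Ico] at h
    have hlen := length_of_mem_evenWords h.1
    have htl : (l.take g).length = g := by rw [List.length_take]; omega
    obtain ⟨A, p, q, hA⟩ := exists_append_singleton (l := l.take g) (by
      intro h0; rw [h0, List.length_nil] at htl; omega)
    have hl : A ++ (p, q) :: l.drop g = l := by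
      conv_rhs => rw [← List.take_append_drop g l, hA]
      simp
    refine ⟨A, p, q, l.drop g, by rw [hl]; exact h.1, ?_⟩
    rw [hl]
    rw [hA] at htl
    simp only [List.length_append, List.length_singleton] at htl
    rw [htl]
  have htake : ∀ (A : List (ℕ × ℕ)) p q B,
      (A ++ (p, q) :: B).take (A.length + 1) = A ++ [(p, q)] := fun A p q B => by
    rw [List.append_cons]; exact List.take_left' (by simp)
  have hdrop : ∀ (A : List (ℕ × ℕ)) p q B,
      (A ++ (p, q) :: B).drop (A.length + 1) = B := fun A p q B => by
    rw [List.append_cons]; exact List.drop_left' (by simp)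
  -- The default `(0, 0)` is never reached, since `g ≥ 1` makes the initial part nonempty.
  let e : List (ℕ × ℕ) × ℕ → β := fun t =>
    ψ (t.1.take t.2).dropLast ((t.1.take t.2).getLastD (0, 0)).1
      ((t.1.take t.2).getLastD (0, 0)).2 (t.1.drop t.2)
  have he : ∀ A p q B, e (A ++ (p, q) :: B, A.length + 1) = ψ A p q B := fun A p q B => by
    simp only [e, htake, hdrop, List.dropLast_concat, List.getLastD_concat]
  symm
  refine Finset.sum_bij (fun t _ => e t) ?_ ?_ ?_ ?_
  · intro t ht
    obtain ⟨A, p, q, B, hm, rfl⟩ := hsplit t ht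
    exact (hmem _).2 ⟨A, p, q, B, hm, (he A p q B).symm⟩
  · intro t ht t' ht' heq
    obtain ⟨A, p, q, B, hm, rfl⟩ := hsplit t ht
    obtain ⟨A', p', q', B', hm', rfl⟩ := hsplit t' ht'
    simp only [he] at heq
    obtain ⟨rfl, rfl, rfl, rfl⟩ := hinj _ _ _ _ _ _ _ _ hm hm' heq
    rfl
  · intro s hs
    obtain ⟨A, p, q, B, hm, rfl⟩ := (hmem s).1 hs
    refine ⟨(A ++ (p, q) :: B, A.length + 1), ?_, he A p q B⟩
    have hlen := length_of_mem_evenWords hm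
    rw [List.length_append, List.length_cons] at hlen
    rw [Finset.mem_product, Finset.mem_Ico]
    exact ⟨hm, by simp only; omega⟩
  · intro t ht
    obtain ⟨A, p, q, B, hm, rfl⟩ := hsplit t ht
    rw [he, hF A p q B hm, htake, hdrop]

theorem perm_split_pair (n p q : ℕ) (A B : List (ℕ × ℕ)) :
    (letters (A ++ (p, 2 * n) :: B) ++ [q]).Perm (List.range (2 * n + 1)) ↔
      (letters (A ++ (p, q) :: B)).Perm (List.range (2 * n)) := by
  rw [List.range_succ, List.perm_iff_count, List.perm_iff_count]
  refine forall_congr' fun c => ?_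
  simp only [letters_append, letters_cons, List.count_append, List.count_cons, List.count_nil]
  omega

theorem perm_split_pair_swap (n p q : ℕ) (A B : List (ℕ × ℕ)) :
    (letters (B ++ (q, 2 * n) :: A) ++ [p]).Perm (List.range (2 * n + 1)) ↔
      (letters (A ++ (p, q) :: B)).Perm (List.range (2 * n)) := by
  rw [List.range_succ, List.perm_iff_count, List.perm_iff_count]
  refine forall_congr' fun c => ?_
  simp only [letters_append, letters_cons, List.count_append, List.count_cons, List.count_nil]
  omega

/-- The maximum takes the place of `q`, which becomes the last letter. -/
theorem mem_oddWords_iff_marked {n p q : ℕ} {A B : List (ℕ × ℕ)} (hpq : p < q) :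
    (A ++ (p, 2 * n) :: B, q) ∈ oddWords n ↔ A ++ (p, q) :: B ∈ evenWords n := by
  rw [mem_oddWords, mem_evenWords, perm_split_pair]
  refine and_congr_right fun h => ?_
  have hp : p < 2 * n := List.mem_range.1 (h.subset (by simp))
  simp only [List.forall_mem_append, List.forall_mem_cons, hp, hpq]

/-- Here `p` becomes the last letter, and `q` is paired with the maximum between the exchanged
parts. -/
theorem mem_oddWords_iff_marked_swap {n p q : ℕ} {A B : List (ℕ × ℕ)} (hpq : p < q) :
    (B ++ (q, 2 * n) :: A, p) ∈ oddWords n ↔ A ++ (p, q) :: B ∈ evenWords n := by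
  rw [mem_oddWords, mem_evenWords, perm_split_pair_swap]
  refine and_congr_right fun h => ?_
  have hp : q < 2 * n := List.mem_range.1 (h.subset (by simp))
  simp only [List.forall_mem_append, List.forall_mem_cons, hp, hpq]
  tauto

/-- The summand contributed by an even word cut in two parts. -/
def cutWeight (f : ℤ → ℤ) (C B : List (ℕ × ℕ)) : ℤ :=
  f (des C + des B + 1 + if lastLetter C < lastLetter B then 1 else 0)

theorem marked_bounds {n p q : ℕ} {A B : List (ℕ × ℕ)} (h : A ++ (p, q) :: B ∈ evenWords n) :
    p < q ∧ q < 2 * n ∧ (∀ r ∈ A, r.1 < 2 * n ∧ r.2 < 2 * n) ∧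
      ∀ r ∈ B, r.1 < 2 * n ∧ r.2 < 2 * n := by
  have h1 := (mem_evenWords.1 h).2
  have h2 := fun r (hr : r ∈ A ++ (p, q) :: B) => snd_lt_of_mem_evenWords h hr
  refine ⟨h1 (p, q) (by simp), h2 (p, q) (by simp), fun r hr => ?_, fun r hr => ?_⟩ <;>
  · have e1 := h1 r (by simp [hr])
    have e2 := h2 r (by simp [hr])
    omega

theorem des_marked {n p q : ℕ} {A B : List (ℕ × ℕ)} (h : A ++ (p, q) :: B ∈ evenWords n)
    (f : ℤ → ℤ) :
    f (des (A ++ (p, 2 * n) :: B ++ [(q, 0)])) = cutWeight f (A ++ [(p, q)]) B := by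
  obtain ⟨-, hq, -, hB⟩ := marked_bounds h
  rw [des_insert_max (fun r hr => (hB r hr).1) hq, cutWeight, des_append_last B,
    lastLetter_append_singleton, des_append_singleton A p 0 q]
  congr 1; ring

theorem des_marked_swap {n p q : ℕ} {A B : List (ℕ × ℕ)} (h : A ++ (p, q) :: B ∈ evenWords n)
    (f : ℤ → ℤ) :
    f (des (B ++ (q, 2 * n) :: A ++ [(p, 0)])) = cutWeight f (A ++ [(p, q)]) B := by
  obtain ⟨hpq, hq, hA, -⟩ := marked_bounds h
  rw [des_insert_max (fun r hr => (hA r hr).1) (hpq.trans hq), cutWeight, des_append_last B,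
    lastLetter_append_singleton, des_append_singleton A p 0 q]
  congr 1; ring

theorem sum_oddWords_last_max (n : ℕ) (f : ℤ → ℤ) :
    ∑ s ∈ (oddWords n).filter (fun s => s.2 = 2 * n), f (des (s.1 ++ [(s.2, 0)])) =
      ∑ l ∈ evenWords n, f (des l) := by
  have hmem : ∀ l, (l, 2 * n) ∈ oddWords n ↔ l ∈ evenWords n := fun l => by
    rw [mem_oddWords, mem_evenWords, List.range_succ, List.perm_append_right_iff]
  symm
  refine Finset.sum_bij (fun l _ => (l, 2 * n)) ?_ ?_ ?_ ?_
  · intro l hl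
    rw [Finset.mem_filter, hmem]
    exact ⟨hl, rfl⟩
  · intro l _ l' _ h
    exact (Prod.mk.inj h).1
  · rintro ⟨l, y⟩ hs
    simp only [Finset.mem_filter] at hs
    obtain ⟨hs, rfl⟩ := hs
    exact ⟨l, (hmem l).1 hs, rfl⟩
  · intro l hl
    have : lastLetter l ≤ 2 * n :=
      Nat.lt_succ_iff.1 (lastLetter_lt (fun p hp => (snd_lt_of_mem_evenWords hl hp).trans
        (Nat.lt_succ_self _)) (Nat.succ_pos _))
    simp only
    rw [des_append_last, if_neg (by omega), add_zero]

theorem exists_eq_of_mem_oddWords {n y : ℕ} {l : List (ℕ × ℕ)} (h : (l, y) ∈ oddWords n)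
    (hy : y ≠ 2 * n) : ∃ A x B, l = A ++ (x, 2 * n) :: B := by
  have hm : 2 * n ∈ letters l := by
    have := (mem_oddWords.1 h).1.symm.subset (List.mem_range.2 (Nat.lt_succ_self (2 * n)))
    simpa [hy.symm] using this
  obtain ⟨⟨u, v⟩, hp, huv⟩ := mem_letters.1 hm
  have h1 := (mem_oddWords.1 h).2 _ hp
  have h2 := snd_lt_of_mem_oddWords h hp
  obtain ⟨A, B, rfl⟩ := List.append_of_mem hp
  refine ⟨A, u, B, ?_⟩
  simp only at h1 h2 huv
  rw [show v = 2 * n by omega]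

-- Odd words whose maximum is not last split by whether its partner is below or above the last
-- letter. Each class is a copy of the even words with a marked pair, with the same weight; hence
-- the factor 2.
open Classical in
theorem sum_oddWords_eq_cutWeight (n : ℕ) (f : ℤ → ℤ) :
    ∑ s ∈ oddWords n, f (des (s.1 ++ [(s.2, 0)])) =
      ∑ l ∈ evenWords n, f (des l) +
        2 * ∑ l ∈ evenWords n, ∑ g ∈ Finset.Ico 1 (n + 1),
          cutWeight f (l.take g) (l.drop g) := by
  rw [← Finset.sum_filter_add_sum_filter_not (oddWords n) (fun s => s.2 = 2 * n),
    sum_oddWords_last_max, ← Finset.sum_filter_add_sum_filter_not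
      ((oddWords n).filter fun s => ¬s.2 = 2 * n)
      (fun s => ∃ A x B, s.1 = A ++ (x, 2 * n) :: B ∧ x < s.2),
    two_mul (∑ l ∈ evenWords n, _)]
  refine congrArg _ (congrArg₂ _ ?_ ?_)
  · refine sum_marked_pairs (fun A p q B => (A ++ (p, 2 * n) :: B, q))
      (fun s => f (des (s.1 ++ [(s.2, 0)]))) (cutWeight f) ?_ ?_
      fun A p q B h => des_marked h f
    · rintro ⟨l, y⟩
      simp only [Finset.mem_filter, Prod.mk.injEq]
      constructor
      · rintro ⟨⟨h, -⟩, A, x, B, rfl, hx⟩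
        exact ⟨A, x, y, B, (mem_oddWords_iff_marked hx).1 h, rfl, rfl⟩
      · rintro ⟨A, p, q, B, h, rfl, rfl⟩
        obtain ⟨hpq, hq, -⟩ := marked_bounds h
        exact ⟨⟨(mem_oddWords_iff_marked hpq).2 h, hq.ne⟩, A, p, B, rfl, hpq⟩
    · intro A p q B A' p' q' B' h h' heq
      rw [Prod.mk.injEq] at heq
      obtain ⟨h1, h2, h3⟩ := append_cons_inj
        (fun r hr => ((marked_bounds h).2.2.1 r hr).2.ne)
        (fun r hr => ((marked_bounds h').2.2.1 r hr).2.ne) heq.1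
      exact ⟨h1, h2, heq.2, h3⟩
  · refine sum_marked_pairs (fun A p q B => (B ++ (q, 2 * n) :: A, p))
      (fun s => f (des (s.1 ++ [(s.2, 0)]))) (cutWeight f) ?_ ?_
      fun A p q B h => des_marked_swap h f
    · rintro ⟨l, y⟩
      simp only [Finset.mem_filter, Prod.mk.injEq]
      constructor
      · rintro ⟨⟨h, hy⟩, hne⟩
        obtain ⟨B, q, A, rfl⟩ := exists_eq_of_mem_oddWords h hy
        have hyq : y < q := by
          have hle : ¬q < y := fun hlt => hne ⟨B, q, A, rfl, hlt⟩
          have hnd := (((perm_split_pair_swap n y q A B).1 (mem_oddWords.1 h).1).nodup_iff).2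
            List.nodup_range
          rw [letters_append, letters_cons] at hnd
          have := (List.nodup_append.1 hnd).2.1
          simp only [List.nodup_cons, List.mem_cons, not_or] at this
          omega
        exact ⟨A, y, q, B, (mem_oddWords_iff_marked_swap hyq).1 h, rfl, rfl⟩
      · rintro ⟨A, p, q, B, h, rfl, rfl⟩
        obtain ⟨hpq, hq, -, hB⟩ := marked_bounds h
        have hodd := (mem_oddWords_iff_marked_swap hpq).2 h
        refine ⟨⟨hodd, (hpq.trans hq).ne⟩, ?_⟩
        -- The maximum occurs once, so its partner is `q` in any splitting, and `q < p` is
        -- impossible.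
        rintro ⟨A', x, B', heq, hx⟩
        have hnd : (letters (B ++ (q, 2 * n) :: A)).Nodup :=
          (List.nodup_append.1 (((mem_oddWords.1 hodd).1.nodup_iff).2 List.nodup_range)).1
        have hA' : ∀ r ∈ A', r.2 ≠ 2 * n := by
          rw [heq, letters_append] at hnd
          intro r hr
          exact (List.nodup_append.1 hnd).2.2 _ (mem_letters.2 ⟨r, hr, Or.inr rfl⟩) _ (by simp)
        obtain ⟨-, rfl, -⟩ := append_cons_inj (fun r hr => (hB r hr).2.ne) hA' heq
        omega
    · intro A p q B A' p' q' B' h h' heq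
      rw [Prod.mk.injEq] at heq
      obtain ⟨h1, h2, h3⟩ := append_cons_inj
        (fun r hr => ((marked_bounds h).2.2.2 r hr).2.ne)
        (fun r hr => ((marked_bounds h').2.2.2 r hr).2.ne) heq.1
      exact ⟨h3, heq.2, h2, h1⟩

theorem lastLetter_take_ne_drop {n g : ℕ} {l : List (ℕ × ℕ)} (h : l ∈ evenWords n)
    (hg : g ∈ Finset.Ico 1 n) : lastLetter (l.take g) ≠ lastLetter (l.drop g) := by
  have hlen := length_of_mem_evenWords h
  rw [Finset.mem_Ico] at hg
  have hnd : (letters l).Nodup := ((mem_evenWords.1 h).1.nodup_iff).2 List.nodup_range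
  rw [← List.take_append_drop g l, letters_append, List.nodup_append] at hnd
  refine hnd.2.2 _ (lastLetter_mem ?_) _ (lastLetter_mem ?_)
  · rw [← List.length_pos_iff, List.length_take]; omega
  · rw [← List.length_pos_iff, List.length_drop]; omega

/-- Exchanging the two parts of a cut symmetrizes the comparison of the last letters. -/
theorem two_mul_sum_cutWeight (n : ℕ) (f : ℤ → ℤ) :
    2 * ∑ l ∈ evenWords n, ∑ g ∈ Finset.Ico 1 n, cutWeight f (l.take g) (l.drop g) =
      ∑ l ∈ evenWords n, ∑ g ∈ Finset.Ico 1 n,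
        (f (des (l.take g) + des (l.drop g) + 1) + f (des (l.take g) + des (l.drop g) + 2)) := by
  rw [two_mul]
  -- In the second copy the parts are exchanged. The last letters differ, so exactly one of the two
  -- copies has the extra descent.
  nth_rewrite 2 [sum_evenWords_swap n (cutWeight f)]
  rw [← Finset.sum_add_distrib]
  refine Finset.sum_congr rfl fun l hl => ?_
  rw [← Finset.sum_add_distrib]
  refine Finset.sum_congr rfl fun g hg => ?_
  have hne := lastLetter_take_ne_drop hl hg
  rw [cutWeight, cutWeight, add_comm (des (l.drop g))]
  rcases lt_or_gt_of_ne hne with h | h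
  · rw [if_pos h, if_neg h.not_gt, add_comm]
    congr 2 <;> ring
  · rw [if_neg h.not_gt, if_pos h]
    congr 2 <;> ring

theorem sum_oddWords {n : ℕ} (hn : 1 ≤ n) (f : ℤ → ℤ) :
    ∑ s ∈ oddWords n, f (des (s.1 ++ [(s.2, 0)])) =
      ∑ l ∈ evenWords n, ((des l + 1) * f (des l) + (n + 1) * f (des l + 1) +
        (n - 1 - des l) * f (des l + 2)) := by
  have hlast : ∑ l ∈ evenWords n, ∑ g ∈ Finset.Ico 1 (n + 1),
        cutWeight f (l.take g) (l.drop g) =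
      ∑ l ∈ evenWords n, ∑ g ∈ Finset.Ico 1 n, cutWeight f (l.take g) (l.drop g) +
        ∑ l ∈ evenWords n, f (des l + 1) := by
    rw [← Finset.sum_add_distrib]
    refine Finset.sum_congr rfl fun l hl => ?_
    -- The cut at `n` has no right part, hence no comparison of last letters, and escapes the
    -- symmetrization.
    rw [Finset.sum_Ico_succ_top hn, ← length_of_mem_evenWords hl, List.take_length,
      List.drop_length, cutWeight]
    simp
  rw [sum_oddWords_eq_cutWeight, hlast, mul_add, two_mul_sum_cutWeight, Finset.mul_sum,
    ← Finset.sum_add_distrib, ← Finset.sum_add_distrib]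
  refine Finset.sum_congr rfl fun l hl => ?_
  have hlen := length_of_mem_evenWords hl
  have key := sum_des_take_add_des_drop l (by rintro rfl; simp at hlen; omega)
    fun d => f (d + 1) + f (d + 2)
  rw [hlen] at key
  rw [key, show des l - 1 + 1 = des l by ring, show des l - 1 + 2 = des l + 1 by ring]
  ring

/-! ### From permutations to words -/

/-- The one-line notation of a permutation. -/
def oneLine {N : ℕ} (π : Equiv.Perm (Fin N)) : List ℕ := List.ofFn fun i => (π i : ℕ)

theorem oneLine_injective {N : ℕ} : Function.Injective (oneLine (N := N)) := by
  intro π σ h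
  ext i
  exact congrFun (List.ofFn_injective h) i

theorem getD_oneLine {N : ℕ} (π : Equiv.Perm (Fin N)) {i : ℕ} (hi : i < N) :
    (oneLine π).getD i 0 = π ⟨i, hi⟩ := by
  rw [List.getD_eq_getElem _ _ (by simpa [oneLine] using hi)]
  simp [oneLine]

theorem oneLine_perm {N : ℕ} (π : Equiv.Perm (Fin N)) : (oneLine π).Perm (List.range N) := by
  have hnd : (oneLine π).Nodup := List.nodup_ofFn.2 (Fin.val_injective.comp π.injective)
  rw [List.perm_ext_iff_of_nodup hnd List.nodup_range]
  intro x
  rw [oneLine, List.mem_ofFn, List.mem_range]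
  constructor
  · rintro ⟨i, rfl⟩
    exact (π i).2
  · intro hx
    exact ⟨π.symm ⟨x, hx⟩, by simp⟩

theorem exists_oneLine_eq {N : ℕ} {w : List ℕ} (hw : w.Perm (List.range N)) :
    ∃ π : Equiv.Perm (Fin N), oneLine π = w := by
  have hlen : w.length = N := by simpa using hw.length_eq
  have hlt : ∀ i : Fin N, w[i.1]'(hlen ▸ i.2) < N := fun i =>
    List.mem_range.1 (hw.subset (List.getElem_mem _))
  have hinj : Function.Injective fun i : Fin N => (⟨w[i.1]'(hlen ▸ i.2), hlt i⟩ : Fin N) := by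
    intro i j h
    have hnd : w.Nodup := hw.nodup_iff.2 List.nodup_range
    exact Fin.ext ((hnd.getElem_inj_iff).1 (Fin.mk.inj h))
  refine ⟨Equiv.ofBijective _ hinj.bijective_of_finite, ?_⟩
  refine List.ext_getElem (by simp [oneLine, hlen]) fun i h1 h2 => ?_
  simp [oneLine]

theorem isDescent_iff {N : ℕ} (π : Equiv.Perm (Fin N)) (i : ℕ) :
    IsDescent π i ↔ (1 ≤ i ∧ i < N) ∧ (oneLine π).getD i 0 < (oneLine π).getD (i - 1) 0 := by
  constructor
  · rintro ⟨h, hd⟩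
    refine ⟨h, ?_⟩
    rwa [getD_oneLine π h.2, getD_oneLine π (by omega)]
  · rintro ⟨h, hd⟩
    rw [getD_oneLine π h.2, getD_oneLine π (by omega)] at hd
    exact ⟨h, hd⟩

theorem odes_eq_zero_iff {N : ℕ} (π : Equiv.Perm (Fin N)) :
    odes π = 0 ↔ ∀ i, Odd i → ¬IsDescent π i := by
  rw [odes, Finset.card_eq_zero, Finset.filter_eq_empty_iff]
  constructor
  · exact fun h i hi hd => h (Finset.mem_range.2 hd.1.2) ⟨hi, hd⟩
  · exact fun h i _ hd => h i hd.1 hd.2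

theorem getD_letters_two_mul (l : List (ℕ × ℕ)) (j : ℕ) :
    (letters l).getD (2 * j) 0 = (l.getD j (0, 0)).1 := by
  induction l generalizing j with
  | nil => simp
  | cons p l ih =>
    cases j with
    | zero => simp
    | succ j =>
      rw [letters_cons, show 2 * (j + 1) = 2 * j + 1 + 1 by ring, List.getD_cons_succ,
        List.getD_cons_succ, List.getD_cons_succ, ih]

theorem getD_letters_two_mul_add_one (l : List (ℕ × ℕ)) (j : ℕ) :
    (letters l).getD (2 * j + 1) 0 = (l.getD j (0, 0)).2 := by
  induction l generalizing j with
  | nil => simp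
  | cons p l ih =>
    cases j with
    | zero => simp
    | succ j =>
      rw [letters_cons, show 2 * (j + 1) + 1 = 2 * j + 1 + 1 + 1 by ring, List.getD_cons_succ,
        List.getD_cons_succ, List.getD_cons_succ, ih]

theorem des_eq_sum (l : List (ℕ × ℕ)) :
    des l = ∑ j ∈ Finset.range (l.length - 1),
      if (l.getD (j + 1) (0, 0)).1 < (l.getD j (0, 0)).2 then 1 else 0 := by
  induction l with
  | nil => simp
  | cons p l ih =>
    cases l with
    | nil => simp
    | cons q l =>
      rw [des_cons_cons, ih, show (p :: q :: l).length - 1 = (q :: l).length - 1 + 1 by simp,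
        Finset.sum_range_succ', add_comm]
      simp only [List.getD_cons_succ, List.getD_cons_zero]

section

variable {N : ℕ} {π : Equiv.Perm (Fin N)} {L : List (ℕ × ℕ)}

/-- The bounds allow `L` to spell one letter more than `π` has, namely the padding of an odd word.
Position `2 * (j + 1)` is the boundary between pairs `j` and `j + 1`. -/
theorem edes_eq_des (hL : N ≤ 2 * L.length) (hL' : 2 * L.length ≤ N + 1)
    (h : ∀ i < N, (oneLine π).getD i 0 = (letters L).getD i 0) : (edes π : ℤ) = des L := by
  rw [des_eq_sum, Finset.sum_boole, edes]
  norm_cast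
  refine (Finset.card_bij (fun j _ => 2 * (j + 1)) ?_ ?_ ?_).symm
  · intro j hj
    rw [Finset.mem_filter, Finset.mem_range] at hj
    rw [Finset.mem_filter, Finset.mem_range, isDescent_iff, h _ (by omega), h _ (by omega),
      getD_letters_two_mul, show 2 * (j + 1) - 1 = 2 * j + 1 by omega,
      getD_letters_two_mul_add_one]
    exact ⟨by omega, even_two_mul _, ⟨by omega, by omega⟩, hj.2⟩
  · intro i _ j _ hij
    omega
  · intro i hi
    rw [Finset.mem_filter, isDescent_iff] at hi
    obtain ⟨-, hev, hi, hd⟩ := hi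
    obtain ⟨j, rfl⟩ : ∃ j, i = 2 * (j + 1) := by
      obtain ⟨k, rfl⟩ := hev
      exact ⟨k - 1, by omega⟩
    rw [h _ (by omega), h _ (by omega), getD_letters_two_mul,
      show 2 * (j + 1) - 1 = 2 * j + 1 by omega, getD_letters_two_mul_add_one] at hd
    refine ⟨j, ?_, rfl⟩
    rw [Finset.mem_filter, Finset.mem_range]
    exact ⟨by omega, hd⟩

theorem odes_eq_zero_iff_getD (h : ∀ i < N, (oneLine π).getD i 0 = (letters L).getD i 0) :
    odes π = 0 ↔ ∀ j, 2 * j + 1 < N → (L.getD j (0, 0)).1 < (L.getD j (0, 0)).2 := by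
  rw [odes_eq_zero_iff]
  have key : ∀ j (hj : 2 * j + 1 < N),
      ¬IsDescent π (2 * j + 1) ↔ (L.getD j (0, 0)).1 < (L.getD j (0, 0)).2 := by
    intro j hj
    rw [← getD_letters_two_mul, ← getD_letters_two_mul_add_one, ← h _ (by omega), ← h _ hj,
      isDescent_iff, Nat.add_sub_cancel]
    have hne : (oneLine π).getD (2 * j) 0 ≠ (oneLine π).getD (2 * j + 1) 0 := by
      rw [getD_oneLine π (by omega), getD_oneLine π hj, Ne, Fin.val_inj, π.injective.eq_iff,
        Fin.mk.injEq]
      omega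
    omega
  constructor
  · exact fun H j hj => (key j hj).1 (H _ ⟨j, rfl⟩)
  · rintro H _ ⟨j, rfl⟩ hd
    exact (key j hd.1.2).2 (H j hd.1.2) hd

end

theorem forall_mem_iff_getD (l : List (ℕ × ℕ)) (P : ℕ × ℕ → Prop) :
    (∀ p ∈ l, P p) ↔ ∀ j < l.length, P (l.getD j (0, 0)) := by
  rw [List.forall_mem_iff_forall_getElem]
  refine forall_congr' fun j => forall_congr' fun hj => ?_
  rw [List.getD_eq_getElem _ _ hj]

theorem a_two_mul (n : ℕ) (k : ℤ) :
    (a (2 * n) k : ℤ) = ∑ l ∈ evenWords n, if des l = k then 1 else 0 := by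
  rw [Finset.sum_boole, a]
  norm_cast
  -- Both sets are embedded in the words over `ℕ`, where their images coincide.
  rw [← Finset.card_image_of_injective _ oneLine_injective,
    ← Finset.card_image_of_injective _ (Function.LeftInverse.injective pairs_letters)]
  congr 1
  ext w
  have key : ∀ (π : Equiv.Perm (Fin (2 * n))) l, oneLine π = letters l → l.length = n →
      ((odes π = 0 ∧ (edes π : ℤ) = k) ↔ (∀ p ∈ l, p.1 < p.2) ∧ des l = k) := by
    intro π l h hl
    have h' : ∀ i < 2 * n, (oneLine π).getD i 0 = (letters l).getD i 0 := fun i _ => by rw [h]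
    rw [odes_eq_zero_iff_getD h', edes_eq_des (by omega) (by omega) h',
      forall_mem_iff_getD l fun p => p.1 < p.2, hl]
    refine and_congr_left fun _ => forall_congr' fun j => ?_
    rw [show 2 * j + 1 < 2 * n ↔ j < n by omega]
  simp only [Finset.mem_image, Finset.mem_filter, Finset.mem_univ, true_and]
  constructor
  · rintro ⟨π, hπ, rfl⟩
    have hp := oneLine_perm π
    have hw : letters (pairs (oneLine π)) = oneLine π :=
      letters_pairs n _ (by simpa using hp.length_eq)
    have hl : (pairs (oneLine π)).length = n := by
      have := hp.length_eq
      rw [← hw, length_letters, List.length_range] at this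
      omega
    obtain ⟨h1, h2⟩ := (key π _ hw.symm hl).1 hπ
    exact ⟨_, ⟨mem_evenWords.2 ⟨by rwa [hw], h1⟩, h2⟩, hw⟩
  · rintro ⟨l, ⟨hl, hd⟩, rfl⟩
    obtain ⟨h1, h2⟩ := mem_evenWords.1 hl
    obtain ⟨π, hπ⟩ := exists_oneLine_eq h1
    exact ⟨π, (key π l hπ (length_of_mem_evenWords hl)).2 ⟨h2, hd⟩, hπ⟩

theorem a_two_mul_add_one (n : ℕ) (k : ℤ) :
    (a (2 * n + 1) k : ℤ) =
      ∑ s ∈ oddWords n, if des (s.1 ++ [(s.2, 0)]) = k then 1 else 0 := by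
  have hinj : Function.Injective fun s : List (ℕ × ℕ) × ℕ => letters s.1 ++ [s.2] := by
    rintro ⟨l, y⟩ ⟨l', y'⟩ h
    obtain ⟨h1, h2⟩ := List.append_inj' h rfl
    rw [Prod.mk.injEq]
    exact ⟨Function.LeftInverse.injective pairs_letters h1, by simpa using h2⟩
  rw [Finset.sum_boole, a]
  norm_cast
  rw [← Finset.card_image_of_injective _ oneLine_injective,
    ← Finset.card_image_of_injective _ hinj]
  congr 1
  ext w
  have key : ∀ (π : Equiv.Perm (Fin (2 * n + 1))) l y, oneLine π = letters l ++ [y] →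
      l.length = n → ((odes π = 0 ∧ (edes π : ℤ) = k) ↔
        (∀ p ∈ l, p.1 < p.2) ∧ des (l ++ [(y, 0)]) = k) := by
    intro π l y h hl
    have h' : ∀ i < 2 * n + 1,
        (oneLine π).getD i 0 = (letters (l ++ [(y, 0)])).getD i 0 := fun i hi => by
      -- The padding letter `0` sits at index `2 * n + 1`, just beyond the range of `i`.
      have hL : letters (l ++ [(y, 0)]) = (letters l ++ [y]) ++ [0] := by simp
      rw [h, hL, List.getD_append (letters l ++ [y]) [0] 0 i (by simp; omega)]
    rw [odes_eq_zero_iff_getD h', edes_eq_des (by simp; omega) (by simp; omega) h',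
      forall_mem_iff_getD l fun p => p.1 < p.2, hl]
    refine and_congr_left fun _ => forall_congr' fun j => ?_
    rw [show 2 * j + 1 < 2 * n + 1 ↔ j < n by omega]
    refine forall_congr' fun hj => ?_
    rw [List.getD_append _ _ _ _ (by omega)]
  simp only [Finset.mem_image, Finset.mem_filter, Finset.mem_univ, true_and]
  constructor
  · rintro ⟨π, hπ, rfl⟩
    have hp := oneLine_perm π
    have hlen : (oneLine π).length = 2 * n + 1 := by simpa using hp.length_eq
    have hne : oneLine π ≠ [] := by intro h0; simp [h0] at hlen
    have hw : letters (pairs (oneLine π).dropLast) = (oneLine π).dropLast :=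
      letters_pairs n _ (by simp [hlen])
    have hl : (pairs (oneLine π).dropLast).length = n := by
      have := congrArg List.length hw
      rw [length_letters, List.length_dropLast, hlen] at this
      omega
    have hsplit : letters (pairs (oneLine π).dropLast) ++ [(oneLine π).getLast hne] =
        oneLine π := by
      rw [hw, List.dropLast_append_getLast]
    obtain ⟨h1, h2⟩ := (key π _ _ hsplit.symm hl).1 hπ
    exact ⟨(_, _), ⟨mem_oddWords.2 ⟨by rwa [hsplit], h1⟩, h2⟩, hsplit⟩
  · rintro ⟨⟨l, y⟩, ⟨hl, hd⟩, rfl⟩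
    obtain ⟨h1, h2⟩ := mem_oddWords.1 hl
    obtain ⟨π, hπ⟩ := exists_oneLine_eq h1
    exact ⟨π, (key π l y hπ (length_of_mem_oddWords hl)).2 ⟨h2, hd⟩, hπ⟩

/-! ### The recurrences -/

theorem a_two_mul_succ (n : ℕ) (k : ℤ) :
    (a (2 * (n + 1)) k : ℤ) =
      ((n : ℤ) + 1 - k) * a (2 * n + 1) (k - 1) + (k + 1) * a (2 * n + 1) k := by
  rw [a_two_mul, a_two_mul_add_one, a_two_mul_add_one,
    sum_evenWords_succ n fun d => if d = k then 1 else 0, Finset.mul_sum, Finset.mul_sum,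
    ← Finset.sum_add_distrib]
  refine Finset.sum_congr rfl fun s _ => ?_
  -- The identity holds word by word, for every value of `d`.
  generalize des (s.1 ++ [(s.2, 0)]) = d
  split_ifs <;> omega

theorem a_two_mul_add_one_rec {n : ℕ} (hn : 1 ≤ n) (k : ℤ) :
    (a (2 * n + 1) k : ℤ) =
      ((n : ℤ) - k + 1) * a (2 * n) (k - 2) + ((n : ℤ) + 1) * a (2 * n) (k - 1) +
        (k + 1) * a (2 * n) k := by
  rw [a_two_mul_add_one, a_two_mul, a_two_mul, a_two_mul,
    sum_oddWords hn fun d => if d = k then 1 else 0, Finset.mul_sum, Finset.mul_sum,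
    Finset.mul_sum, ← Finset.sum_add_distrib, ← Finset.sum_add_distrib]
  refine Finset.sum_congr rfl fun l _ => ?_
  generalize des l = d
  have e1 : d + 1 = k ↔ d = k - 1 := by omega
  have e2 : d + 2 = k ↔ d = k - 2 := by omega
  simp only [e1, e2]
  split_ifs <;> omega

/-! ### The boundary values -/

theorem eq_one_of_no_descents {m : ℕ} {π : Equiv.Perm (Fin (m + 1))}
    (h : ∀ i, ¬IsDescent π i) : π = 1 := by
  have hmono : StrictMono π := Fin.strictMono_iff_lt_succ.2 fun i => by
    by_contra hlt
    have hne : π i.castSucc ≠ π i.succ := π.injective.ne (by simp [Fin.ext_iff])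
    refine h (i + 1) ⟨⟨by omega, by omega⟩, ?_⟩
    exact lt_of_le_of_ne (not_lt.1 hlt) hne.symm
  refine Equiv.ext fun i => ?_
  exact congrFun ((hmono.range_inj strictMono_id).1
    (by rw [π.surjective.range_eq, Set.range_id])) i

theorem a_zero {n : ℕ} (hn : 1 ≤ n) : a n 0 = 1 := by
  obtain ⟨m, rfl⟩ : ∃ m, n = m + 1 := ⟨n - 1, by omega⟩
  rw [a, Finset.card_eq_one]
  refine ⟨1, ?_⟩
  ext π
  rw [Finset.mem_filter, Finset.mem_singleton, odes_eq_zero_iff, Nat.cast_eq_zero, edes,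
    Finset.card_eq_zero, Finset.filter_eq_empty_iff]
  constructor
  · rintro ⟨-, h1, h2⟩
    refine eq_one_of_no_descents fun i hd => ?_
    rcases Nat.even_or_odd i with hi | hi
    · exact h2 (Finset.mem_range.2 hd.1.2) ⟨hi, hd⟩
    · exact h1 i hi hd
  · rintro rfl
    have hno : ∀ i, ¬IsDescent (1 : Equiv.Perm (Fin (m + 1))) i := by
      rintro i ⟨h, hd⟩
      simp only [Equiv.Perm.coe_one, id_eq, gt_iff_lt, Fin.mk_lt_mk] at hd
      omega
    exact ⟨Finset.mem_univ _, fun i _ => hno i, fun i _ h => hno i h.2⟩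

theorem card_even_positions (n : ℕ) :
    ((Finset.range n).filter fun i => Even i ∧ 1 ≤ i).card = (n - 1) / 2 := by
  rw [← Finset.card_range ((n - 1) / 2)]
  refine (Finset.card_bij (fun j _ => 2 * (j + 1)) ?_ ?_ ?_).symm
  · intro j hj
    rw [Finset.mem_range] at hj
    rw [Finset.mem_filter, Finset.mem_range]
    exact ⟨by omega, even_two_mul _, by omega⟩
  · intro i _ j _ hij
    omega
  · intro i hi
    rw [Finset.mem_filter, Finset.mem_range] at hi
    obtain ⟨h1, ⟨k, rfl⟩, h2⟩ := hi
    exact ⟨k - 1, Finset.mem_range.2 (by omega), by omega⟩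

theorem edes_eq_max_iff {n : ℕ} (π : Equiv.Perm (Fin n)) :
    edes π = (n - 1) / 2 ↔ ∀ i, 1 ≤ i → i < n → Even i → IsDescent π i := by
  have hsub : ((Finset.range n).filter fun i => Even i ∧ IsDescent π i) ⊆
      (Finset.range n).filter fun i => Even i ∧ 1 ≤ i :=
    Finset.monotone_filter_right _ fun i _ hi => ⟨hi.1, hi.2.1.1⟩
  rw [edes, ← card_even_positions]
  constructor
  · intro h i h1 h2 h3
    have := Finset.eq_of_subset_of_card_le hsub h.ge
    have hi : i ∈ (Finset.range n).filter fun i => Even i ∧ 1 ≤ i := by simp [h1, h2, h3]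
    rw [← this, Finset.mem_filter] at hi
    exact hi.2.2
  · intro h
    refine congrArg _ (hsub.antisymm fun i hi => ?_)
    rw [Finset.mem_filter, Finset.mem_range] at hi ⊢
    exact ⟨hi.1, hi.2.1, h i hi.2.2 hi.1 hi.2.1⟩

/-- With `(n - 1) / 2` even descents, every even position is a descent and no odd one is. Reversing
the order of the values turns this pattern into the alternating one. -/
theorem a_max {n : ℕ} (hn : 1 ≤ n) : a n (((n : ℤ) - 1) / 2) = eulerNumber n := by
  classical
  rw [a, eulerNumber]
  refine Finset.card_equiv (Equiv.mulLeft Fin.revPerm) fun π => ?_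
  rw [Finset.mem_filter, Finset.mem_filter, odes_eq_zero_iff,
    show ((n : ℤ) - 1) / 2 = ((n - 1) / 2 : ℕ) by omega, Nat.cast_inj, edes_eq_max_iff]
  simp only [Finset.mem_univ, true_and, IsAlternating, Equiv.coe_mulLeft, Equiv.Perm.coe_mul,
    Function.comp_apply, Fin.revPerm_apply, gt_iff_lt, Fin.rev_lt_rev]
  have hne : ∀ (i : ℕ) (h : 1 ≤ i ∧ i < n), π ⟨i - 1, by omega⟩ ≠ π ⟨i, h.2⟩ := fun i h =>
    π.injective.ne (by rw [Ne, Fin.mk.injEq]; omega)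
  constructor
  · rintro ⟨h1, h2⟩ i h
    refine ⟨fun hi => ?_, fun hi => ?_⟩
    · exact lt_of_le_of_ne (not_lt.1 fun hlt => h1 i hi ⟨h, hlt⟩) (hne i h)
    · exact (h2 i h.1 h.2 hi).2
  · intro H
    refine ⟨fun i hi hd => ?_, fun i h1 h2 hi => ?_⟩
    · exact lt_asymm ((H i hd.1).1 hi) hd.2
    · exact ⟨⟨h1, h2⟩, (H i ⟨h1, h2⟩).2 hi⟩

end RefinedEulerian

theorem theorem3p6 :
    (∀ n k : ℕ, 1 ≤ k → k ≤ n →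
      (RefinedEulerian.a (2 * n) k : ℤ) =
          ((n : ℤ) - k) * RefinedEulerian.a (2 * n - 1) ((k : ℤ) - 1)
            + ((k : ℤ) + 1) * RefinedEulerian.a (2 * n - 1) k ∧
      (RefinedEulerian.a (2 * n + 1) k : ℤ) =
          ((n : ℤ) - k + 1) * RefinedEulerian.a (2 * n) ((k : ℤ) - 2)
            + ((n : ℤ) + 1) * RefinedEulerian.a (2 * n) ((k : ℤ) - 1)
            + ((k : ℤ) + 1) * RefinedEulerian.a (2 * n) k) ∧
    (∀ n : ℕ, 1 ≤ n →
      RefinedEulerian.a n 0 = 1 ∧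
      RefinedEulerian.a n (((n : ℤ) - 1) / 2) = RefinedEulerian.eulerNumber n) := by
  refine ⟨fun n k hk hkn => ⟨?_, RefinedEulerian.a_two_mul_add_one_rec (hk.trans hkn) k⟩,
    fun n hn => ⟨RefinedEulerian.a_zero hn, RefinedEulerian.a_max hn⟩⟩
  obtain ⟨m, rfl⟩ : ∃ m, n = m + 1 := ⟨n - 1, by omega⟩
  rw [RefinedEulerian.a_two_mul_succ, show 2 * (m + 1) - 1 = 2 * m + 1 by omega]
  push_cast
  ring
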